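/- The set of real roots of the equation $2\cos(\sqrt3\,x)=-e^{-3x}$ is infinite, consists of positive numbers, and can be enumerated as a strictly increasing sequence $r_0<r_1<r_2<\cdots$ (which is then unique). With this enumeration, $$\sum_{n=0}^\infty r_n^{-6}=\frac85 .$$ Moreover, put $\alpha=e^{2\pi i/3}$ and $f(z)=2e^{3z}\cos(\sqrt3\,z)+1$ for $z\in\mathbb C$. Then the set of complex zeros of $f$ is exactly $$\{z\in\mathbb C: f(z)=0\}=\{\,r_n,\ \alpha r_n,\ \alpha^2 r_n : n=0,1,2,\dots\},$$ and every zero of $f$ is simple (of order exactly $1$). -/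

import Mathlib

/-- The entire function `f(z) = 2 e^{3z} cos(√3 z) + 1`. -/
noncomputable def cosExpFun (z : ℂ) : ℂ :=
  2 * Complex.exp (3 * z) * Complex.cos ((Real.sqrt 3 : ℂ) * z) + 1

/-- The primitive cube root of unity `α = e^{2πi/3}`. -/
noncomputable def cubeRootUnity : ℂ :=
  Complex.exp (2 * (Real.pi : ℂ) * Complex.I / 3)

/-!
Let `E(w) = ∑ w ^ j / (3 j)!`, so that `f(z) = 3 e^{2z} E((-2z) ^ 3)`. Every `w` is `(-2z) ^ 3` for
some `z` in the sector `|arg z| ≤ π / 3`, and there the only zeros of `f` are the positive ones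
`r_n`, one in each interval `(nπ/√3, (n+1)π/√3)`; hence the zeros of `E` are exactly the numbers
`(-2 r_n) ^ 3`, and those of `f` their cube roots divided by `-2`. On the circles
`|w| = (2mπ/√3) ^ 3`, which run between these zeros, the logarithmic derivative `L` of `E` is
bounded. Dividing out the zeros inside such a circle and applying the Cauchy estimate to the
derivative of `L` at `0` gives, as `m → ∞`, `∑ (-2 r_n) ^ (-6) = -(dL/dw)(0) = 1 / 40`.
-/

/-! ### Logarithmic derivatives and simple zeros -/

theorem analyticAt_dslope {𝕜 E : Type*} [NontriviallyNormedField 𝕜] [NormedAddCommGroup E]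
    [NormedSpace 𝕜 E] {f : 𝕜 → E} {z : 𝕜} (hf : AnalyticAt 𝕜 f z) (a : 𝕜) :
    AnalyticAt 𝕜 (dslope f a) z := by
  rcases eq_or_ne z a with rfl | hza
  · obtain ⟨p, hp⟩ := hf
    exact ⟨_, hp.has_fpower_series_dslope_fslope⟩
  · have hslope : AnalyticAt 𝕜 (fun w => (w - a)⁻¹ • (f w - f a)) z :=
      ((analyticAt_id.sub analyticAt_const).inv (sub_ne_zero.2 hza)).smul (hf.sub analyticAt_const)
    exact hslope.congr (dslope_eventuallyEq_slope_of_ne f hza).symm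

section SimpleZeros

variable {𝕜 : Type*} [NontriviallyNormedField 𝕜] {ι : Type*} {s : Finset ι} {ρ : ι → 𝕜}
  {g Q : 𝕜 → 𝕜} {U : Set 𝕜}

theorem exists_analyticOnNhd_eq_mul_prod_sub (hg : AnalyticOnNhd 𝕜 g U)
    (hinj : Set.InjOn ρ s) (hzero : ∀ i ∈ s, g (ρ i) = 0) :
    ∃ Q : 𝕜 → 𝕜, AnalyticOnNhd 𝕜 Q U ∧ ∀ z, g z = Q z * ∏ i ∈ s, (z - ρ i) := by
  classical
  induction s using Finset.induction_on with
  | empty => exact ⟨g, hg, by simp⟩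
  | insert a s has ih =>
    rw [Finset.coe_insert, Set.injOn_insert (by simpa using has)] at hinj
    obtain ⟨Q, hQ, hgQ⟩ := ih hinj.1 fun i hi => hzero i (Finset.mem_insert_of_mem hi)
    have hprod : ∏ i ∈ s, (ρ a - ρ i) ≠ 0 := Finset.prod_ne_zero_iff.2 fun i hi =>
      sub_ne_zero.2 fun h => hinj.2 ⟨i, hi, h.symm⟩
    have hQa : Q (ρ a) = 0 := by
      have := hzero a (Finset.mem_insert_self a s)
      rw [hgQ] at this
      exact (mul_eq_zero.1 this).resolve_right hprod
    refine ⟨dslope Q (ρ a), fun z hz => analyticAt_dslope (hQ z hz) _, fun z => ?_⟩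
    have hQz : (z - ρ a) * dslope Q (ρ a) z = Q z := by
      simpa [hQa] using sub_smul_dslope Q (ρ a) z
    rw [Finset.prod_insert has, hgQ, ← hQz]
    ring

theorem exists_analyticOnNhd_ne_zero_eq_mul_prod_sub (hg : AnalyticOnNhd 𝕜 g U)
    (hinj : Set.InjOn ρ s) (hsimple : ∀ i ∈ s, g (ρ i) = 0 ∧ deriv g (ρ i) ≠ 0)
    (hall : ∀ z ∈ U, g z = 0 → ∃ i ∈ s, ρ i = z) :
    ∃ Q : 𝕜 → 𝕜, AnalyticOnNhd 𝕜 Q U ∧ (∀ z ∈ U, Q z ≠ 0) ∧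
      ∀ z, g z = Q z * ∏ i ∈ s, (z - ρ i) := by
  obtain ⟨Q, hQ, hgQ⟩ := exists_analyticOnNhd_eq_mul_prod_sub hg hinj fun i hi => (hsimple i hi).1
  refine ⟨Q, hQ, fun z hz hQz => ?_, hgQ⟩
  obtain ⟨i, hi, rfl⟩ := hall z hz (by rw [hgQ, hQz, zero_mul])
  refine (hsimple i hi).2 ?_
  have hprod : DifferentiableAt 𝕜 (fun z : 𝕜 => ∏ j ∈ s, (z - ρ j)) (ρ i) := by fun_prop
  rw [funext hgQ, deriv_fun_mul (hQ _ hz).differentiableAt hprod, hQz,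
    Finset.prod_eq_zero hi (sub_self _), mul_zero, zero_mul, add_zero]

theorem logDeriv_eq_logDeriv_sub_sum (hgQ : ∀ z, g z = Q z * ∏ i ∈ s, (z - ρ i)) {z : 𝕜}
    (hQ : DifferentiableAt 𝕜 Q z) (hz : g z ≠ 0) :
    logDeriv Q z = logDeriv g z - ∑ i ∈ s, (z - ρ i)⁻¹ := by
  obtain ⟨hQz, hprod⟩ := mul_ne_zero_iff.1 (hgQ z ▸ hz)
  have hsum : logDeriv (fun z => ∏ i ∈ s, (z - ρ i)) z = ∑ i ∈ s, (z - ρ i)⁻¹ := by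
    rw [logDeriv_prod (fun i hi => Finset.prod_ne_zero_iff.1 hprod i hi) fun i _ => by fun_prop]
    simp [logDeriv_apply]
  rw [funext hgQ, logDeriv_mul z hQz hprod hQ (by fun_prop), hsum, add_sub_cancel_right]

end SimpleZeros

theorem iteratedDeriv_inv_sub {𝕜 : Type*} [NontriviallyNormedField 𝕜] (n : ℕ) (a c : 𝕜) :
    iteratedDeriv n (fun z => (z - a)⁻¹) c = -(n.factorial : 𝕜) * ((a - c) ^ (n + 1))⁻¹ := by
  have h := congrFun (iter_deriv_inv_linear_sub n (1 : 𝕜) a) c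
  have hexp : -1 - (n : ℤ) = -((n + 1 : ℕ) : ℤ) := by push_cast; ring
  have hneg : ((c - a) ^ (n + 1))⁻¹ = -(-1) ^ n * ((a - c) ^ (n + 1))⁻¹ := by
    rw [← neg_sub a c, neg_pow, mul_inv, ← inv_pow, inv_neg, inv_one, pow_succ, mul_neg_one]
  have hsign : (-1 : 𝕜) ^ n * (-1) ^ n = 1 := by rw [← mul_pow]; simp
  simp only [one_mul] at h
  rw [iteratedDeriv_eq_iterate, h, hexp, zpow_neg, zpow_natCast, hneg, one_pow]
  linear_combination (-(n.factorial : 𝕜) * ((a - c) ^ (n + 1))⁻¹) * hsign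

-- Dividing `g` by its zeros leaves a zero-free `Q`, and `logDeriv Q = logDeriv g - ∑ 1 / (z - ρ i)`
-- is then subject to the Cauchy estimate.
theorem norm_iteratedDeriv_logDeriv_add_sum_le {ι : Type*} {s : Finset ι} {ρ : ι → ℂ} {g : ℂ → ℂ}
    {c : ℂ} {R C d : ℝ} (n : ℕ) (hR : 0 < R) (hd : 0 < d)
    (hg : AnalyticOnNhd ℂ g (Metric.closedBall c R)) (hgc : g c ≠ 0) (hinj : Set.InjOn ρ s)
    (hsimple : ∀ i ∈ s, g (ρ i) = 0 ∧ deriv g (ρ i) ≠ 0)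
    (hall : ∀ z ∈ Metric.closedBall c R, g z = 0 → ∃ i ∈ s, ρ i = z)
    (hC : ∀ z ∈ Metric.sphere c R, ‖logDeriv g z‖ ≤ C)
    (hdist : ∀ z ∈ Metric.sphere c R, ∀ i ∈ s, d ≤ ‖z - ρ i‖) :
    ‖iteratedDeriv n (logDeriv g) c + n.factorial * ∑ i ∈ s, ((ρ i - c) ^ (n + 1))⁻¹‖ ≤
      n.factorial * (C + s.card / d) / R ^ n := by
  obtain ⟨Q, hQ, hQ_ne, hgQ⟩ := exists_analyticOnNhd_ne_zero_eq_mul_prod_sub hg hinj hsimple hall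
  have hc := Metric.mem_closedBall_self (x := c) hR.le
  have hdiff : DiffContOnCl ℂ (logDeriv Q) (Metric.ball c R) := by
    refine DifferentiableOn.diffContOnCl ?_
    rw [closure_ball c hR.ne']
    exact (hQ.deriv.div hQ hQ_ne).differentiableOn
  have hbound : ∀ z ∈ Metric.sphere c R, ‖logDeriv Q z‖ ≤ C + s.card / d := by
    intro z hz
    have hz' := Metric.sphere_subset_closedBall hz
    have hgz : g z ≠ 0 := fun h => by
      obtain ⟨i, hi, rfl⟩ := hall z hz' h
      simpa using hd.trans_le (hdist _ hz i hi)
    have hsum : ‖∑ i ∈ s, (z - ρ i)⁻¹‖ ≤ s.card / d := by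
      rw [div_eq_mul_inv, ← nsmul_eq_mul]
      refine (norm_sum_le _ _).trans (Finset.sum_le_card_nsmul _ _ _ fun i hi => ?_)
      rw [norm_inv]
      exact inv_anti₀ hd (hdist z hz i hi)
    rw [logDeriv_eq_logDeriv_sub_sum hgQ (hQ z hz').differentiableAt hgz]
    exact (norm_sub_le _ _).trans (add_le_add (hC z hz) hsum)
  have hev : logDeriv Q =ᶠ[nhds c] fun z => logDeriv g z - ∑ i ∈ s, (z - ρ i)⁻¹ := by
    filter_upwards [(hQ c hc).eventually_analyticAt,
      (hg c hc).continuousAt.eventually_ne hgc] with z hQz hgz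
    exact logDeriv_eq_logDeriv_sub_sum hgQ hQz.differentiableAt hgz
  have hlog : ContDiffAt ℂ n (logDeriv g) c := ((hg c hc).deriv.div (hg c hc) hgc).contDiffAt
  have hinv : ∀ i ∈ s, ContDiffAt ℂ n (fun z => (z - ρ i)⁻¹) c := fun i hi =>
    (contDiffAt_id.sub contDiffAt_const).inv
      (sub_ne_zero.2 fun (h : c = ρ i) => hgc (h ▸ (hsimple i hi).1))
  have hmain := Complex.norm_iteratedDeriv_le_of_forall_mem_sphere_norm_le n hR hdiff hbound
  rw [hev.iteratedDeriv_eq, iteratedDeriv_fun_sub hlog (ContDiffAt.sum hinv),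
    iteratedDeriv_fun_sum hinv] at hmain
  simp only [iteratedDeriv_inv_sub] at hmain
  rwa [← Finset.mul_sum, neg_mul, sub_neg_eq_add] at hmain

/-! ### The Mittag-Leffler function -/

/-- The Mittag-Leffler function `E_k(w) = ∑ w ^ j / (k j)!`, which is entire for `k ≠ 0`. It is
the series with `k E_k(z ^ k) = ∑ exp (ζ ^ j z)`, `ζ` a primitive `k`-th root of unity. -/
noncomputable def mittagLeffler (k : ℕ) : ℂ → ℂ :=
  FormalMultilinearSeries.ofScalarsSum fun j => ((k * j).factorial : ℂ)⁻¹

section MittagLeffler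

variable {k : ℕ}

theorem radius_ofScalars_inv_factorial_mul (hk : k ≠ 0) :
    (FormalMultilinearSeries.ofScalars ℂ fun j => ((k * j).factorial : ℂ)⁻¹).radius = ⊤ := by
  refine FormalMultilinearSeries.ofScalars_radius_eq_top_of_tendsto ℂ _
    (.of_forall fun j => inv_ne_zero (Nat.cast_ne_zero.2 (Nat.factorial_ne_zero _)))
    (squeeze_zero (fun _ => by positivity) (fun j => ?_)
      (tendsto_one_div_add_atTop_nhds_zero_nat (𝕜 := ℝ)))
  have hle : (j + 1) * (k * j).factorial ≤ (k * j.succ).factorial :=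
    calc (j + 1) * (k * j).factorial ≤ (k * j + 1) * (k * j).factorial := by
          gcongr
          exact Nat.le_mul_of_pos_left j (Nat.pos_of_ne_zero hk)
      _ = (k * j + 1).factorial := (Nat.factorial_succ _).symm
      _ ≤ (k * j.succ).factorial := Nat.factorial_le (by rw [Nat.mul_succ]; omega)
  rw [norm_inv, norm_inv, Complex.norm_natCast, Complex.norm_natCast, inv_div_inv,
    div_le_div_iff₀ (by positivity) (by positivity), one_mul, mul_comm]
  exact_mod_cast hle

theorem hasFPowerSeriesOnBall_mittagLeffler (hk : k ≠ 0) :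
    HasFPowerSeriesOnBall (mittagLeffler k)
      (FormalMultilinearSeries.ofScalars ℂ fun j => ((k * j).factorial : ℂ)⁻¹) 0 ⊤ := by
  rw [← radius_ofScalars_inv_factorial_mul hk]
  exact FormalMultilinearSeries.hasFPowerSeriesOnBall _
    (radius_ofScalars_inv_factorial_mul hk ▸ ENNReal.zero_lt_top)

theorem hasSum_mittagLeffler (hk : k ≠ 0) (w : ℂ) :
    HasSum (fun j => w ^ j / (k * j).factorial) (mittagLeffler k w) := by
  have h := (hasFPowerSeriesOnBall_mittagLeffler hk).hasSum (y := w) (by simp)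
  rw [zero_add] at h
  simpa [FormalMultilinearSeries.ofScalars_apply_eq, div_eq_mul_inv, mul_comm] using h

theorem analyticOnNhd_mittagLeffler (hk : k ≠ 0) (s : Set ℂ) :
    AnalyticOnNhd ℂ (mittagLeffler k) s :=
  fun w _ => (hasFPowerSeriesOnBall_mittagLeffler hk).analyticOnNhd w (by simp)

theorem iteratedDeriv_mittagLeffler_zero (hk : k ≠ 0) (n : ℕ) :
    iteratedDeriv n (mittagLeffler k) 0 = n.factorial / (k * n).factorial := by
  have h := (hasFPowerSeriesOnBall_mittagLeffler hk).factorial_smul (1 : ℂ) n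
  rw [iteratedDeriv_eq_iteratedFDeriv]
  simpa [FormalMultilinearSeries.ofScalars_apply_eq, div_eq_mul_inv] using h.symm

theorem mittagLeffler_apply_zero (hk : k ≠ 0) : mittagLeffler k 0 = 1 := by
  simpa using iteratedDeriv_mittagLeffler_zero hk 0

end MittagLeffler

theorem sum_range_pow_pow_of_isPrimitiveRoot {R : Type*} [CommRing R] [IsDomain R] {k : ℕ} {ζ : R}
    (hζ : IsPrimitiveRoot ζ k) (n : ℕ) :
    ∑ j ∈ Finset.range k, (ζ ^ j) ^ n = if k ∣ n then (k : R) else 0 := by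
  simp_rw [← pow_mul, mul_comm _ n, pow_mul]
  split_ifs with h
  · simp [(hζ.pow_eq_one_iff_dvd n).2 h]
  · have hne : ζ ^ n - 1 ≠ 0 := sub_ne_zero.2 fun e => h ((hζ.pow_eq_one_iff_dvd n).1 e)
    have hgeom := geom_sum_mul (ζ ^ n) k
    rw [← pow_mul, mul_comm n, pow_mul, hζ.pow_eq_one, one_pow, sub_self] at hgeom
    exact (mul_eq_zero.1 hgeom).resolve_right hne

theorem mul_mittagLeffler_pow {k : ℕ} (hk : k ≠ 0) {ζ : ℂ} (hζ : IsPrimitiveRoot ζ k) (z : ℂ) :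
    k * mittagLeffler k (z ^ k) = ∑ j ∈ Finset.range k, Complex.exp (ζ ^ j * z) := by
  have hexp : HasSum (fun n : ℕ => ∑ j ∈ Finset.range k, (ζ ^ j * z) ^ n / n.factorial)
      (∑ j ∈ Finset.range k, Complex.exp (ζ ^ j * z)) :=
    hasSum_sum fun j _ => by
      rw [Complex.exp_eq_exp_ℂ]
      exact NormedSpace.expSeries_div_hasSum_exp _
  have hterm (n : ℕ) : ∑ j ∈ Finset.range k, (ζ ^ j * z) ^ n / n.factorial =
      (if k ∣ n then (k : ℂ) else 0) * (z ^ n / n.factorial) := by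
    rw [← sum_range_pow_pow_of_isPrimitiveRoot hζ, Finset.sum_mul]
    exact Finset.sum_congr rfl fun j _ => by rw [mul_pow, mul_div_assoc]
  have hinj : Function.Injective (k * ·) := mul_right_injective₀ hk
  simp_rw [hterm] at hexp
  rw [← hinj.hasSum_iff] at hexp
  · refine HasSum.unique ?_ hexp
    simpa [Function.comp_def, pow_mul] using (hasSum_mittagLeffler hk (z ^ k)).mul_left (k : ℂ)
  · intro n hn
    rw [if_neg fun ⟨j, hj⟩ => hn ⟨j, hj.symm⟩, zero_mul]

theorem deriv_logDeriv_mittagLeffler_zero {k : ℕ} (hk : k ≠ 0) :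
    deriv (logDeriv (mittagLeffler k)) 0 =
      2 / (2 * k).factorial - (1 / (k.factorial : ℂ)) ^ 2 := by
  have hE := analyticOnNhd_mittagLeffler hk Set.univ 0 trivial
  have h0 := mittagLeffler_apply_zero hk
  have h1 : deriv (mittagLeffler k) 0 = 1 / k.factorial := by
    simpa using iteratedDeriv_mittagLeffler_zero hk 1
  have h2 : deriv (deriv (mittagLeffler k)) 0 = 2 / (2 * k).factorial := by
    simpa [iteratedDeriv_succ, mul_comm k] using iteratedDeriv_mittagLeffler_zero hk 2
  have hquot : HasDerivAt (logDeriv (mittagLeffler k)) _ 0 :=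
    hE.deriv.differentiableAt.hasDerivAt.div hE.differentiableAt.hasDerivAt (by simp [h0])
  rw [hquot.deriv, h0, h1, h2]
  ring

/-! ### Real zeros -/

theorem cos_eq_mk (w : ℂ) : Complex.cos w =
    ⟨Real.cos w.re * Real.cosh w.im, -(Real.sin w.re * Real.sinh w.im)⟩ := by
  rw [Complex.cos_eq, Complex.mk_eq_add_mul_I]
  push_cast
  ring

theorem norm_cos_sq (w : ℂ) : ‖Complex.cos w‖ ^ 2 = Real.cos w.re ^ 2 + Real.sinh w.im ^ 2 := by
  rw [← Complex.normSq_eq_norm_sq, Complex.normSq_apply, cos_eq_mk]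
  linear_combination Real.cos w.re ^ 2 * Real.cosh_sq w.im +
    Real.sinh w.im ^ 2 * Real.sin_sq_add_cos_sq w.re

theorem norm_sin_le_one_add_norm_cos (w : ℂ) : ‖Complex.sin w‖ ≤ 1 + ‖Complex.cos w‖ := by
  have h : Complex.sin w ^ 2 = 1 - Complex.cos w ^ 2 :=
    eq_sub_of_add_eq (Complex.sin_sq_add_cos_sq w)
  have hle := norm_sub_le (1 : ℂ) (Complex.cos w ^ 2)
  rw [← h, norm_pow, norm_pow, norm_one] at hle
  exact abs_le_of_sq_le_sq' (by linarith [norm_nonneg (Complex.cos w)]) (by positivity) |>.2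

theorem sq_le_sinh_sq (x : ℝ) : x ^ 2 ≤ Real.sinh x ^ 2 := by
  rw [sq_le_sq, Real.abs_sinh]
  exact Real.self_le_sinh_iff.2 (abs_nonneg x)

theorem sqrt_three_le_two : √3 ≤ 2 :=
  Real.sqrt_le_iff.2 ⟨by norm_num, by norm_num⟩

theorem cosExpFun_eq_zero_iff {z : ℂ} :
    cosExpFun z = 0 ↔ 2 * Complex.cos (√3 * z) = -Complex.exp (-3 * z) := by
  have hexp : Complex.exp (3 * z) * Complex.exp (-3 * z) = 1 := by
    rw [← Complex.exp_add]
    simp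
  rw [← mul_right_inj' (Complex.exp_ne_zero (3 * z)) (b := 2 * _), mul_neg, hexp,
    ← add_eq_zero_iff_eq_neg, cosExpFun]
  ring_nf

theorem cosExpFun_ofReal_eq_zero_iff {x : ℝ} :
    cosExpFun x = 0 ↔ 2 * Real.cos (√3 * x) = -Real.exp (-3 * x) := by
  rw [cosExpFun_eq_zero_iff]
  exact_mod_cast Iff.rfl

theorem two_mul_norm_cos_of_cosExpFun_eq_zero {z : ℂ} (h : cosExpFun z = 0) :
    2 * ‖Complex.cos (√3 * z)‖ = Real.exp (-(3 * z.re)) := by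
  simpa [Complex.norm_exp] using congrArg norm (cosExpFun_eq_zero_iff.1 h)

theorem norm_cos_lt_half_of_cosExpFun_eq_zero {z : ℂ} (hz : 0 < z.re) (h : cosExpFun z = 0) :
    ‖Complex.cos (√3 * z)‖ < 1 / 2 := by
  have hexp : Real.exp (-(3 * z.re)) < 1 := Real.exp_lt_one_iff.2 (by linarith)
  linarith [two_mul_norm_cos_of_cosExpFun_eq_zero h]

-- With `E = exp (-3 re z)`, a nonzero imaginary part would give `4 cos² (√3 re z) ≤ E²` (modulus)
-- and `4 sin² (√3 re z) ≤ 3 E²` (imaginary part), hence `1 ≤ E²`.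
theorem im_eq_zero_of_cosExpFun_eq_zero {z : ℂ} (hz : 0 < z.re) (h : cosExpFun z = 0) :
    z.im = 0 := by
  by_contra him
  have hnorm : 4 * (Real.cos (√3 * z.re) ^ 2 + Real.sinh (√3 * z.im) ^ 2) =
      Real.exp (-(3 * z.re)) ^ 2 := by
    rw [← two_mul_norm_cos_of_cosExpFun_eq_zero h, mul_pow, norm_cos_sq, Complex.re_ofReal_mul,
      Complex.im_ofReal_mul]
    norm_num
  have himag : -(2 * (Real.sin (√3 * z.re) * Real.sinh (√3 * z.im))) =
      Real.exp (-(3 * z.re)) * Real.sin (3 * z.im) := by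
    simpa [cos_eq_mk, Complex.exp_im] using
      congrArg Complex.im (cosExpFun_eq_zero_iff.1 h)
  have hsinh : 3 * z.im ^ 2 ≤ Real.sinh (√3 * z.im) ^ 2 := by
    simpa [mul_pow] using sq_le_sinh_sq (√3 * z.im)
  have hsin : Real.sin (3 * z.im) ^ 2 ≤ 3 * Real.sinh (√3 * z.im) ^ 2 := by
    linarith [Real.sin_sq_le_sq (x := 3 * z.im)]
  have hsinh_pos : 0 < Real.sinh (√3 * z.im) ^ 2 := by positivity
  have hsin_le : 4 * Real.sin (√3 * z.re) ^ 2 ≤ 3 * Real.exp (-(3 * z.re)) ^ 2 := by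
    refine le_of_mul_le_mul_right ?_ hsinh_pos
    calc 4 * Real.sin (√3 * z.re) ^ 2 * Real.sinh (√3 * z.im) ^ 2
        = Real.exp (-(3 * z.re)) ^ 2 * Real.sin (3 * z.im) ^ 2 := by
          linear_combination (-2 * (Real.sin (√3 * z.re) * Real.sinh (√3 * z.im)) +
            Real.exp (-(3 * z.re)) * Real.sin (3 * z.im)) * himag
      _ ≤ 3 * Real.exp (-(3 * z.re)) ^ 2 * Real.sinh (√3 * z.im) ^ 2 := by
          linarith [mul_le_mul_of_nonneg_left hsin (sq_nonneg (Real.exp (-(3 * z.re))))]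
  have hexp : Real.exp (-(3 * z.re)) ^ 2 < 1 :=
    pow_lt_one₀ (Real.exp_nonneg _) (Real.exp_lt_one_iff.2 (by linarith)) two_ne_zero
  linarith [Real.sin_sq_add_cos_sq (√3 * z.re)]

theorem abs_cos_lt_half_of_cosExpFun_eq_zero {x : ℝ} (hx : 0 < x) (h : cosExpFun x = 0) :
    |Real.cos (√3 * x)| < 1 / 2 := by
  have := norm_cos_lt_half_of_cosExpFun_eq_zero (z := x) (by simpa using hx) h
  rwa [← Complex.ofReal_mul, ← Complex.ofReal_cos, Complex.norm_real] at this

theorem pos_of_cosExpFun_eq_zero {x : ℝ} (h : cosExpFun x = 0) : 0 < x := by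
  rw [cosExpFun_ofReal_eq_zero_iff] at h
  by_contra! hx
  have hx_ge : -1 / 3 ≤ x := by
    linarith [Real.add_one_le_exp (-3 * x), Real.neg_one_le_cos (√3 * x)]
  have hcos : 0 < Real.cos (√3 * x) := by
    apply Real.cos_pos_of_mem_Ioo
    constructor <;> nlinarith [sqrt_three_le_two, Real.sqrt_nonneg 3, Real.pi_gt_three]
  linarith [Real.exp_pos (-3 * x)]

theorem strictAntiOn_exp_mul_cos :
    StrictAntiOn (fun t => Real.exp (√3 * t) * Real.cos t) (Set.Icc (Real.pi / 3) Real.pi) := by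
  refine strictAntiOn_of_deriv_neg (convex_Icc _ _) (by fun_prop) fun t ht => ?_
  rw [interior_Icc] at ht
  have hderiv : HasDerivAt (fun t => Real.exp (√3 * t) * Real.cos t)
      (Real.exp (√3 * t) * (√3 * 1) * Real.cos t + Real.exp (√3 * t) * -Real.sin t) t :=
    ((hasDerivAt_id t).const_mul _).exp.mul (Real.hasDerivAt_cos t)
  have hsin : 0 < Real.sin (t - Real.pi / 3) := by
    apply Real.sin_pos_of_pos_of_lt_pi <;> linarith [ht.1, ht.2, Real.pi_pos]
  rw [Real.sin_sub, Real.cos_pi_div_three, Real.sin_pi_div_three] at hsin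
  rw [hderiv.deriv]
  nlinarith [Real.exp_pos (√3 * t)]

theorem pi_div_three_le_of_exp_mul_cos_le_half {t : ℝ} (ht : t ∈ Set.Ioo 0 Real.pi)
    (h : Real.exp (√3 * t) * Real.cos t ≤ 1 / 2) : Real.pi / 3 ≤ t := by
  by_contra! hlt
  have hcos : 1 / 2 < Real.cos t := by
    rw [← Real.cos_pi_div_three]
    exact Real.cos_lt_cos_of_nonneg_of_le_pi ht.1.le (by linarith [Real.pi_pos]) hlt
  have hexp : 1 ≤ Real.exp (√3 * t) := Real.one_le_exp (mul_nonneg (Real.sqrt_nonneg 3) ht.1.le)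
  nlinarith

theorem existsUnique_exp_mul_cos_eq {v : ℝ} (hv : |v| ≤ 1 / 2) :
    ∃! t, t ∈ Set.Ioo 0 Real.pi ∧ Real.exp (√3 * t) * Real.cos t = v := by
  obtain ⟨hv_ge, hv_le⟩ := abs_le.1 hv
  have hexp : 1 ≤ Real.exp (√3 * Real.pi) :=
    Real.one_le_exp (mul_nonneg (Real.sqrt_nonneg 3) Real.pi_pos.le)
  have hmem : v ∈ Set.Ioo (Real.exp (√3 * Real.pi) * Real.cos Real.pi)
      (Real.exp (√3 * 0) * Real.cos 0) := by
    simp only [Real.cos_pi, mul_zero, Real.exp_zero, Real.cos_zero, Set.mem_Ioo]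
    constructor <;> linarith
  have hcont : ContinuousOn (fun t => Real.exp (√3 * t) * Real.cos t) (Set.Icc 0 Real.pi) := by
    fun_prop
  have hIcc {t : ℝ} (ht : t ∈ Set.Ioo 0 Real.pi ∧ Real.exp (√3 * t) * Real.cos t = v) :
      t ∈ Set.Icc (Real.pi / 3) Real.pi :=
    ⟨pi_div_three_le_of_exp_mul_cos_le_half ht.1 (ht.2.trans_le hv_le), ht.1.2.le⟩
  obtain ⟨t, ht⟩ := intermediate_value_Ioo' Real.pi_pos.le hcont hmem
  exact ⟨t, ht, fun u hu =>
    strictAntiOn_exp_mul_cos.injOn (hIcc hu) (hIcc ht) (hu.2.trans ht.2.symm)⟩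

theorem cosExpFun_ofReal_eq_zero_iff_exp_mul_cos_sub (n : ℕ) {x : ℝ} : cosExpFun x = 0 ↔
    Real.exp (√3 * (√3 * x - n * Real.pi)) * Real.cos (√3 * x - n * Real.pi) =
      -1 / 2 * ((-1) ^ n * Real.exp (-(√3 * (n * Real.pi)))) := by
  have hexp : Real.exp (√3 * (√3 * x - n * Real.pi)) =
      Real.exp (3 * x) * Real.exp (-(√3 * (n * Real.pi))) := by
    rw [← Real.exp_add]
    congr 1
    linear_combination x * Real.mul_self_sqrt (show (0 : ℝ) ≤ 3 by norm_num)
  have hinv : Real.exp (-3 * x) = (Real.exp (3 * x))⁻¹ := by rw [← Real.exp_neg, neg_mul]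
  have hne : (-1) ^ n * Real.exp (-(√3 * (n * Real.pi))) ≠ 0 :=
    mul_ne_zero (pow_ne_zero _ (by norm_num)) (Real.exp_ne_zero _)
  rw [cosExpFun_ofReal_eq_zero_iff, Real.cos_sub_nat_mul_pi, hexp, hinv,
    show Real.exp (3 * x) * Real.exp (-(√3 * (n * Real.pi))) * ((-1) ^ n * Real.cos (√3 * x)) =
      Real.exp (3 * x) * Real.cos (√3 * x) * ((-1) ^ n * Real.exp (-(√3 * (n * Real.pi)))) by ring,
    mul_left_inj' hne]
  field_simp

theorem existsUnique_cosExpFun_ofReal_eq_zero (n : ℕ) :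
    ∃! x : ℝ, √3 * x ∈ Set.Ioo (n * Real.pi) ((n + 1) * Real.pi) ∧ cosExpFun x = 0 := by
  have hv : |-1 / 2 * ((-1) ^ n * Real.exp (-(√3 * (n * Real.pi))))| ≤ 1 / 2 := by
    have hexp : Real.exp (-(√3 * (n * Real.pi))) ≤ 1 :=
      Real.exp_le_one_iff.2 (neg_nonpos.2 (by positivity))
    simp only [abs_mul, abs_pow, abs_neg, abs_one, one_pow, one_mul, Real.abs_exp, abs_div,
      Nat.abs_ofNat]
    linarith
  have hsqrt : √3 ≠ 0 := by positivity
  refine (((Equiv.mulLeft₀ (√3) hsqrt).trans (Equiv.subRight (n * Real.pi))).existsUnique_congr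
    fun x => and_congr ?_ (cosExpFun_ofReal_eq_zero_iff_exp_mul_cos_sub n)).2
    (existsUnique_exp_mul_cos_eq hv)
  simp [Set.mem_Ioo, sub_lt_iff_lt_add, add_mul, add_comm]

/-- The `n`-th root `r_n` of `2 cos (√3 x) = -e^{-3x}`, picked out as the only one in the interval
`(nπ/√3, (n+1)π/√3)`. -/
noncomputable def realRoot (n : ℕ) : ℝ := (existsUnique_cosExpFun_ofReal_eq_zero n).choose

theorem sqrt_three_mul_realRoot_mem_Ioo (n : ℕ) :
    √3 * realRoot n ∈ Set.Ioo (n * Real.pi) ((n + 1) * Real.pi) :=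
  (existsUnique_cosExpFun_ofReal_eq_zero n).choose_spec.1.1

theorem cosExpFun_realRoot (n : ℕ) : cosExpFun (realRoot n) = 0 :=
  (existsUnique_cosExpFun_ofReal_eq_zero n).choose_spec.1.2

theorem realRoot_pos (n : ℕ) : 0 < realRoot n :=
  pos_of_cosExpFun_eq_zero (cosExpFun_realRoot n)

theorem strictMono_realRoot : StrictMono realRoot := by
  refine strictMono_nat_of_lt_succ fun n => lt_of_mul_lt_mul_left ?_ (Real.sqrt_nonneg 3)
  have h := (sqrt_three_mul_realRoot_mem_Ioo (n + 1)).1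
  push_cast at h
  exact (sqrt_three_mul_realRoot_mem_Ioo n).2.trans h

theorem exists_realRoot_eq {x : ℝ} (h : cosExpFun x = 0) : ∃ n, realRoot n = x := by
  have hx := pos_of_cosExpFun_eq_zero h
  have hle := Nat.floor_le (a := √3 * x / Real.pi) (by positivity)
  have hlt := Nat.lt_floor_add_one (√3 * x / Real.pi)
  set n := ⌊√3 * x / Real.pi⌋₊
  rw [le_div_iff₀ Real.pi_pos] at hle
  rw [div_lt_iff₀ Real.pi_pos] at hlt
  have hne : n * Real.pi ≠ √3 * x := fun heq => by
    have hcos := abs_cos_lt_half_of_cosExpFun_eq_zero hx h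
    rw [← heq, ← Int.cast_natCast, Real.abs_cos_int_mul_pi] at hcos
    norm_num at hcos
  exact ⟨n, (existsUnique_cosExpFun_ofReal_eq_zero n).unique
    ⟨sqrt_three_mul_realRoot_mem_Ioo n, cosExpFun_realRoot n⟩ ⟨⟨lt_of_le_of_ne hle hne, hlt⟩, h⟩⟩

theorem range_realRoot : Set.range realRoot =
    {x : ℝ | 2 * Real.cos (√3 * x) = -Real.exp (-3 * x)} := by
  ext x
  rw [Set.mem_ofPred_eq, ← cosExpFun_ofReal_eq_zero_iff]
  exact ⟨fun ⟨n, hn⟩ => hn ▸ cosExpFun_realRoot n, exists_realRoot_eq⟩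

theorem exists_eq_realRoot_of_re_pos {z : ℂ} (hz : 0 < z.re) (h : cosExpFun z = 0) :
    ∃ n, z = realRoot n := by
  have heq : (z.re : ℂ) = z :=
    Complex.ext rfl (im_eq_zero_of_cosExpFun_eq_zero hz h).symm
  obtain ⟨n, hn⟩ := exists_realRoot_eq (heq.symm ▸ h)
  exact ⟨n, by rw [hn, heq]⟩

/-! ### Complex zeros -/

theorem exists_pow_eq_norm_mul_cos_le_re {k : ℕ} (hk : k ≠ 0) (w : ℂ) :
    ∃ z : ℂ, z ^ k = w ∧ ‖z‖ * Real.cos (Real.pi / k) ≤ z.re := by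
  refine ⟨w ^ (k⁻¹ : ℂ), Complex.cpow_nat_inv_pow w hk, ?_⟩
  rcases eq_or_ne w 0 with rfl | hw
  · simp [hk]
  have him : (Complex.log w * (k⁻¹ : ℂ)).im = w.arg / k := by
    rw [← Complex.ofReal_natCast, ← Complex.ofReal_inv, Complex.im_mul_ofReal, Complex.log_im,
      div_eq_mul_inv]
  rw [Complex.cpow_def_of_ne_zero hw, Complex.exp_re, Complex.norm_exp, him,
    ← Real.cos_abs (w.arg / k), abs_div, Nat.abs_cast]
  gcongr
  refine Real.cos_le_cos_of_nonneg_of_le_pi (by positivity) ?_ ?_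
  · exact div_le_self Real.pi_pos.le (by exact_mod_cast Nat.one_le_iff_ne_zero.2 hk)
  · gcongr
    exact Complex.abs_arg_le_pi w

theorem pow_eq_pow_iff_of_isPrimitiveRoot {F : Type*} [Field F] {k : ℕ} [NeZero k] {ζ : F}
    (hζ : IsPrimitiveRoot ζ k) {x y : F} :
    x ^ k = y ^ k ↔ ∃ j < k, x = ζ ^ j * y := by
  constructor
  · intro h
    rcases eq_or_ne y 0 with rfl | hy
    · rw [zero_pow (NeZero.ne k)] at h
      exact ⟨0, Nat.pos_of_neZero k, by simp [eq_zero_of_pow_eq_zero h]⟩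
    · obtain ⟨j, hj, hxy⟩ := hζ.eq_pow_of_pow_eq_one (ξ := x / y)
        (by rw [div_pow, h, div_self (pow_ne_zero k hy)])
      exact ⟨j, hj, by rw [hxy, div_mul_cancel₀ x hy]⟩
  · rintro ⟨j, -, rfl⟩
    rw [mul_pow, ← pow_mul, mul_comm j, pow_mul, hζ.pow_eq_one, one_pow, one_mul]

theorem isPrimitiveRoot_cubeRootUnity : IsPrimitiveRoot cubeRootUnity 3 := by
  simpa [cubeRootUnity] using Complex.isPrimitiveRoot_exp 3 (by norm_num)

theorem ofReal_sqrt_three_sq : (√3 : ℂ) ^ 2 = 3 := by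
  exact_mod_cast Real.sq_sqrt (show (0 : ℝ) ≤ 3 by norm_num)

theorem cubeRootUnity_eq : cubeRootUnity = -1 / 2 + √3 / 2 * Complex.I := by
  have h : 2 * (Real.pi : ℂ) * Complex.I / 3 = ((Real.pi - Real.pi / 3 : ℝ) : ℂ) * Complex.I := by
    push_cast
    ring
  rw [cubeRootUnity, h, Complex.exp_mul_I, ← Complex.ofReal_cos, ← Complex.ofReal_sin,
    Real.cos_pi_sub, Real.sin_pi_sub, Real.cos_pi_div_three, Real.sin_pi_div_three]
  push_cast
  ring

theorem cubeRootUnity_sq : cubeRootUnity ^ 2 = -1 / 2 - √3 / 2 * Complex.I := by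
  rw [cubeRootUnity_eq]
  linear_combination (Complex.I ^ 2 / 4) * ofReal_sqrt_three_sq + (3 / 4 : ℂ) * Complex.I_sq

theorem cosExpFun_eq_mittagLeffler (z : ℂ) :
    cosExpFun z = 3 * Complex.exp (2 * z) * mittagLeffler 3 ((-2 * z) ^ 3) := by
  have hE : 3 * mittagLeffler 3 ((-2 * z) ^ 3) = Complex.exp (-2 * z) +
      Complex.exp (cubeRootUnity * (-2 * z)) + Complex.exp (cubeRootUnity ^ 2 * (-2 * z)) := by
    simpa [Finset.sum_range_succ] using
      mul_mittagLeffler_pow three_ne_zero isPrimitiveRoot_cubeRootUnity (-2 * z)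
  have hexponent : 2 * z + cubeRootUnity * (-2 * z) = 3 * z + -(√3 * z) * Complex.I := by
    rw [cubeRootUnity_eq]
    ring
  have hexponent_sq : 2 * z + cubeRootUnity ^ 2 * (-2 * z) = 3 * z + √3 * z * Complex.I := by
    rw [cubeRootUnity_sq]
    ring
  rw [mul_comm 3, mul_assoc, hE, mul_add, mul_add, ← Complex.exp_add, ← Complex.exp_add,
    ← Complex.exp_add, hexponent, hexponent_sq, ← add_mul, add_neg_cancel, zero_mul,
    Complex.exp_zero, Complex.exp_add, Complex.exp_add, cosExpFun, Complex.cos]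
  ring

theorem cosExpFun_eq_zero_iff_mittagLeffler {z : ℂ} :
    cosExpFun z = 0 ↔ mittagLeffler 3 ((-2 * z) ^ 3) = 0 := by
  rw [cosExpFun_eq_mittagLeffler]
  simp [Complex.exp_ne_zero]

theorem ne_zero_of_cosExpFun_eq_zero {z : ℂ} (h : cosExpFun z = 0) : z ≠ 0 := by
  rintro rfl
  norm_num [cosExpFun] at h

theorem exists_neg_two_mul_pow_three_eq (w : ℂ) :
    ∃ z : ℂ, (-2 * z) ^ 3 = w ∧ ‖z‖ ≤ 2 * z.re := by
  obtain ⟨z, hz, hre⟩ := exists_pow_eq_norm_mul_cos_le_re three_ne_zero (w / -8)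
  rw [Nat.cast_ofNat, Real.cos_pi_div_three] at hre
  exact ⟨z, by rw [mul_pow, hz]; ring, by linarith⟩

theorem mittagLeffler_three_eq_zero_iff {w : ℂ} :
    mittagLeffler 3 w = 0 ↔ ∃ n, (-2 * (realRoot n : ℂ)) ^ 3 = w := by
  constructor
  · intro h
    obtain ⟨z, rfl, hsector⟩ := exists_neg_two_mul_pow_three_eq w
    have hz := cosExpFun_eq_zero_iff_mittagLeffler.2 h
    have hnorm := norm_pos_iff.2 (ne_zero_of_cosExpFun_eq_zero hz)
    obtain ⟨n, rfl⟩ := exists_eq_realRoot_of_re_pos (by linarith) hz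
    exact ⟨n, rfl⟩
  · rintro ⟨n, rfl⟩
    exact cosExpFun_eq_zero_iff_mittagLeffler.1 (cosExpFun_realRoot n)

theorem cosExpFun_eq_zero_iff_exists {z : ℂ} : cosExpFun z = 0 ↔
    ∃ n : ℕ, z = (realRoot n : ℂ) ∨ z = cubeRootUnity * (realRoot n : ℂ) ∨
      z = cubeRootUnity ^ 2 * (realRoot n : ℂ) := by
  have hlt (j : ℕ) : j < 3 ↔ j = 0 ∨ j = 1 ∨ j = 2 := by omega
  rw [cosExpFun_eq_zero_iff_mittagLeffler, mittagLeffler_three_eq_zero_iff]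
  refine exists_congr fun n => ?_
  rw [mul_pow, mul_pow, mul_right_inj' (by norm_num), eq_comm,
    pow_eq_pow_iff_of_isPrimitiveRoot isPrimitiveRoot_cubeRootUnity]
  simp only [hlt, or_and_right, exists_or, exists_eq_left, pow_zero, one_mul, pow_one]

theorem hasDerivAt_cosExpFun (z : ℂ) : HasDerivAt cosExpFun
    (2 * Complex.exp (3 * z) * (3 * Complex.cos (√3 * z) - √3 * Complex.sin (√3 * z))) z := by
  have hexp : HasDerivAt (fun z : ℂ => Complex.exp (3 * z)) (Complex.exp (3 * z) * (3 * 1)) z :=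
    ((hasDerivAt_id z).const_mul 3).cexp
  have hcos : HasDerivAt (fun z : ℂ => Complex.cos (√3 * z))
      (-Complex.sin (√3 * z) * (√3 * 1)) z :=
    ((hasDerivAt_id z).const_mul (√3 : ℂ)).ccos
  convert! ((hexp.const_mul 2).mul hcos).add_const 1 using 1
  ring

theorem deriv_cosExpFun_eq (z : ℂ) : deriv cosExpFun z = 2 * cosExpFun z -
    72 * z ^ 2 * Complex.exp (2 * z) * deriv (mittagLeffler 3) ((-2 * z) ^ 3) := by
  have hexp : HasDerivAt (fun z : ℂ => 3 * Complex.exp (2 * z))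
      (3 * (Complex.exp (2 * z) * (2 * 1))) z :=
    ((hasDerivAt_id z).const_mul 2).cexp.const_mul 3
  have hpow : HasDerivAt (fun z : ℂ => (-2 * z) ^ 3) _ z :=
    ((hasDerivAt_id z).const_mul (-2)).pow 3
  have hE : HasDerivAt (mittagLeffler 3) _ ((-2 * z) ^ 3) :=
    (analyticOnNhd_mittagLeffler three_ne_zero Set.univ _ trivial).differentiableAt.hasDerivAt
  have hderiv := (hexp.mul (hE.comp z hpow)).deriv
  rw [cosExpFun_eq_mittagLeffler, funext cosExpFun_eq_mittagLeffler]
  refine hderiv.trans ?_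
  simp only [Function.comp_apply, id_eq]
  ring

-- A double zero of `f` satisfies `4 cos² (√3 z) = 1`, hence `e^{-6z} = 1`.
theorem deriv_cosExpFun_ne_zero_of_re_ne_zero {z : ℂ} (hre : z.re ≠ 0) (h : cosExpFun z = 0) :
    deriv cosExpFun z ≠ 0 := by
  rw [(hasDerivAt_cosExpFun z).deriv]
  refine mul_ne_zero (mul_ne_zero two_ne_zero (Complex.exp_ne_zero _)) fun hderiv => hre ?_
  have hcos : 4 * Complex.cos (√3 * z) ^ 2 = 1 := by
    linear_combination
      (1 / 3 * (3 * Complex.cos (√3 * z) + √3 * Complex.sin (√3 * z))) * hderiv +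
        Complex.sin_sq_add_cos_sq (√3 * z) +
        1 / 3 * Complex.sin (√3 * z) ^ 2 * ofReal_sqrt_three_sq
  have hnorm : 4 * ‖Complex.cos (√3 * z)‖ ^ 2 = 1 := by simpa using congrArg norm hcos
  have hexp : Real.exp (-(3 * z.re)) ^ 2 = 1 := by
    rw [← two_mul_norm_cos_of_cosExpFun_eq_zero h]
    linear_combination hnorm
  rw [← Real.exp_nat_mul, Real.exp_eq_one_iff] at hexp
  simpa using hexp

theorem deriv_mittagLeffler_three_ne_zero {w : ℂ} (h : mittagLeffler 3 w = 0) :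
    deriv (mittagLeffler 3) w ≠ 0 := by
  obtain ⟨n, rfl⟩ := mittagLeffler_three_eq_zero_iff.1 h
  intro hderiv
  refine deriv_cosExpFun_ne_zero_of_re_ne_zero (z := realRoot n)
    (by simpa using (realRoot_pos n).ne') (cosExpFun_realRoot n) ?_
  rw [deriv_cosExpFun_eq, cosExpFun_realRoot, hderiv, mul_zero, mul_zero, sub_zero]

theorem deriv_cosExpFun_ne_zero {z : ℂ} (h : cosExpFun z = 0) : deriv cosExpFun z ≠ 0 := by
  have hE := deriv_mittagLeffler_three_ne_zero (cosExpFun_eq_zero_iff_mittagLeffler.1 h)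
  have hz := ne_zero_of_cosExpFun_eq_zero h
  rw [deriv_cosExpFun_eq, h, mul_zero, zero_sub, neg_ne_zero]
  exact mul_ne_zero (mul_ne_zero (mul_ne_zero (by norm_num) (pow_ne_zero 2 hz))
    (Complex.exp_ne_zero _)) hE

theorem analyticOrderAt_cosExpFun {z : ℂ} (h : cosExpFun z = 0) :
    analyticOrderAt cosExpFun z = 1 := by
  have hdiff : Differentiable ℂ cosExpFun := fun w => (hasDerivAt_cosExpFun w).differentiableAt
  exact (hdiff.analyticAt z).analyticOrderAt_eq_one_of_zero_deriv_ne_zero h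
    (deriv_cosExpFun_ne_zero h)

/-! ### The sum over the zeros -/

theorem one_sub_abs_sub_int_mul_pi_le_abs_cos (x : ℝ) (m : ℤ) :
    1 - |x - m * Real.pi| ≤ |Real.cos x| := by
  have hlip := Real.abs_cos_sub_cos_le (m * Real.pi) x
  have htri := abs_sub_abs_le_abs_sub (Real.cos (m * Real.pi)) (Real.cos x)
  rw [Real.abs_cos_int_mul_pi] at htri
  rw [abs_sub_comm (m * Real.pi)] at hlip
  linarith

theorem one_le_of_sqrt_three_mul_eq {m : ℕ} (hm : m ≠ 0) {R : ℝ} (hR : √3 * R = m * Real.pi) :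
    1 ≤ R := by
  have hm_ge : (1 : ℝ) ≤ m := by exact_mod_cast Nat.one_le_iff_ne_zero.2 hm
  have hR_ge : √3 * 1 ≤ √3 * R := by
    rw [hR]
    nlinarith [sqrt_three_le_two, Real.pi_gt_three]
  exact le_of_mul_le_mul_left hR_ge (by positivity)

theorem half_le_norm_cos_sqrt_three_mul {m : ℕ} (hm : m ≠ 0) {z : ℂ} (hz : √3 * ‖z‖ = m * Real.pi)
    (hre : ‖z‖ ≤ 2 * z.re) : 1 / 2 ≤ ‖Complex.cos (√3 * z)‖ := by
  suffices (1 / 2) ^ 2 ≤ Real.cos (√3 * z.re) ^ 2 + Real.sinh (√3 * z.im) ^ 2 by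
    rwa [← Complex.re_ofReal_mul, ← Complex.im_ofReal_mul, ← norm_cos_sq,
      pow_le_pow_iff_left₀ (by norm_num) (norm_nonneg _) two_ne_zero] at this
  rcases le_or_gt ((1 / 2) ^ 2) ((√3 * z.im) ^ 2) with him | him
  · linarith [sq_le_sinh_sq (√3 * z.im), sq_nonneg (Real.cos (√3 * z.re))]
  · have hnorm := one_le_of_sqrt_three_mul_eq hm hz
    have hnorm_sq : ‖z‖ ^ 2 = z.re ^ 2 + z.im ^ 2 := by
      rw [Complex.sq_norm, Complex.normSq_apply]
      ring
    have hsub : ‖z‖ - z.re ≤ 1 / 4 := by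
      rw [mul_pow, Real.sq_sqrt (by norm_num)] at him
      nlinarith [Complex.re_le_norm z]
    have hdist : |√3 * z.re - (m : ℤ) * Real.pi| ≤ 1 / 2 := by
      rw [Int.cast_natCast, ← hz, ← mul_sub, abs_mul, abs_of_nonneg (Real.sqrt_nonneg 3),
        abs_sub_comm, abs_of_nonneg (sub_nonneg.2 (Complex.re_le_norm z))]
      nlinarith [sqrt_three_le_two, Complex.re_le_norm z]
    have hcos : 1 / 2 ≤ |Real.cos (√3 * z.re)| := by
      linarith [one_sub_abs_sub_int_mul_pi_le_abs_cos (√3 * z.re) m]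
    rw [← sq_abs (Real.cos _)]
    linarith [pow_le_pow_left₀ (by norm_num) hcos 2, sq_nonneg (Real.sinh (√3 * z.im))]

theorem norm_logDeriv_cosExpFun_le {z : ℂ} (hre : 1 / 3 ≤ z.re)
    (hcos : 1 / 2 ≤ ‖Complex.cos (√3 * z)‖) : ‖logDeriv cosExpFun z‖ ≤ 18 := by
  have hinv : Complex.exp (3 * z) * Complex.exp (-3 * z) = 1 := by
    rw [← Complex.exp_add]
    simp
  have hexp : ‖Complex.exp (-3 * z) / 2‖ ≤ 1 / 4 := by
    have hre_eq : (-3 * z).re = -(3 * z.re) := by simp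
    have htwo : 2 ≤ Real.exp (3 * z.re) := by linarith [Real.add_one_le_exp (3 * z.re)]
    rw [norm_div, Complex.norm_exp, Complex.norm_ofNat, hre_eq, Real.exp_neg]
    linarith [inv_anti₀ two_pos htwo]
  have hf : cosExpFun z =
      2 * Complex.exp (3 * z) * (Complex.cos (√3 * z) + Complex.exp (-3 * z) / 2) := by
    rw [cosExpFun]
    linear_combination -hinv
  have hden : ‖Complex.cos (√3 * z)‖ / 2 ≤
      ‖Complex.cos (√3 * z) + Complex.exp (-3 * z) / 2‖ := by
    linarith [norm_sub_le_norm_add (Complex.cos (√3 * z)) (Complex.exp (-3 * z) / 2)]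
  have hnum : ‖3 * Complex.cos (√3 * z) - √3 * Complex.sin (√3 * z)‖ ≤
      9 * ‖Complex.cos (√3 * z)‖ := by
    refine (norm_sub_le _ _).trans ?_
    rw [norm_mul, norm_mul, Complex.norm_real, Complex.norm_ofNat,
      Real.norm_of_nonneg (Real.sqrt_nonneg 3)]
    nlinarith [sqrt_three_le_two, norm_nonneg (Complex.sin (√3 * z)),
      norm_sin_le_one_add_norm_cos (√3 * z)]
  rw [logDeriv_apply, (hasDerivAt_cosExpFun z).deriv, hf, mul_div_mul_left _ _
    (mul_ne_zero two_ne_zero (Complex.exp_ne_zero _)), norm_div, div_le_iff₀ (by linarith)]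
  linarith

theorem logDeriv_cosExpFun {z : ℂ} (h : cosExpFun z ≠ 0) :
    logDeriv cosExpFun z = 2 - 24 * z ^ 2 * logDeriv (mittagLeffler 3) ((-2 * z) ^ 3) := by
  have hexp := mul_ne_zero three_ne_zero (Complex.exp_ne_zero (2 * z))
  rw [logDeriv_apply, logDeriv_apply, deriv_cosExpFun_eq, sub_div, mul_div_cancel_right₀ _ h,
    cosExpFun_eq_mittagLeffler, ← mul_div_mul_left _ (mittagLeffler 3 _) hexp]
  ring

theorem norm_logDeriv_mittagLeffler_three_le {m : ℕ} (hm : m ≠ 0) {R : ℝ}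
    (hR : √3 * R = m * Real.pi) {w : ℂ} (hw : ‖w‖ = (2 * R) ^ 3) :
    ‖logDeriv (mittagLeffler 3) w‖ ≤ 1 := by
  have hR_ge := one_le_of_sqrt_three_mul_eq hm hR
  obtain ⟨z, rfl, hsector⟩ := exists_neg_two_mul_pow_three_eq w
  obtain rfl : ‖z‖ = R := by
    rw [norm_pow, norm_mul, norm_neg, Complex.norm_ofNat,
      pow_left_inj₀ (by positivity) (by linarith) three_ne_zero] at hw
    linarith
  have hcos := half_le_norm_cos_sqrt_three_mul hm hR hsector
  have hf : cosExpFun z ≠ 0 := fun h =>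
    hcos.not_gt (norm_cos_lt_half_of_cosExpFun_eq_zero (by linarith) h)
  have hbound : ‖24 * z ^ 2 * logDeriv (mittagLeffler 3) ((-2 * z) ^ 3)‖ ≤ 20 := by
    rw [show 24 * z ^ 2 * logDeriv (mittagLeffler 3) ((-2 * z) ^ 3) = 2 - logDeriv cosExpFun z by
      rw [logDeriv_cosExpFun hf, sub_sub_cancel]]
    refine (norm_sub_le _ _).trans ?_
    rw [Complex.norm_ofNat]
    linarith [norm_logDeriv_cosExpFun_le (z := z) (by linarith) hcos]
  rw [norm_mul, norm_mul, norm_pow, Complex.norm_ofNat] at hbound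
  nlinarith [norm_nonneg (logDeriv (mittagLeffler 3) ((-2 * z) ^ 3)),
    one_le_pow₀ hR_ge (n := 2)]

theorem norm_neg_two_mul_realRoot_pow (n : ℕ) :
    ‖(-2 * (realRoot n : ℂ)) ^ 3‖ = (2 * realRoot n) ^ 3 := by
  rw [norm_pow, norm_mul, norm_neg, Complex.norm_ofNat, Complex.norm_of_nonneg (realRoot_pos n).le]

theorem injective_neg_two_mul_realRoot_pow :
    Function.Injective fun n => (-2 * (realRoot n : ℂ)) ^ 3 := by
  intro m n h
  have hnorm := congrArg norm h
  simp only [norm_neg_two_mul_realRoot_pow] at hnorm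
  rw [pow_left_inj₀ (by linarith [realRoot_pos m]) (by linarith [realRoot_pos n]) three_ne_zero,
    mul_right_inj' two_ne_zero] at hnorm
  exact strictMono_realRoot.injective hnorm

theorem lt_of_realRoot_le {m n : ℕ} {R : ℝ} (hR : √3 * R = m * Real.pi) (h : realRoot n ≤ R) :
    n < m := by
  have hlt : n * Real.pi < m * Real.pi :=
    (sqrt_three_mul_realRoot_mem_Ioo n).1.trans_le
      (hR ▸ mul_le_mul_of_nonneg_left h (Real.sqrt_nonneg 3))
  exact_mod_cast lt_of_mul_lt_mul_right hlt Real.pi_pos.le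

theorem one_quarter_le_abs_sub_realRoot {m : ℕ} {R : ℝ} (hR : √3 * R = m * Real.pi) (n : ℕ) :
    1 / 4 ≤ |R - realRoot n| := by
  have hcos := abs_cos_lt_half_of_cosExpFun_eq_zero (realRoot_pos n) (cosExpFun_realRoot n)
  have hle := one_sub_abs_sub_int_mul_pi_le_abs_cos (√3 * realRoot n) m
  rw [Int.cast_natCast, ← hR, ← mul_sub, abs_mul, abs_of_nonneg (Real.sqrt_nonneg 3),
    abs_sub_comm] at hle
  nlinarith [sqrt_three_le_two, abs_nonneg (R - realRoot n)]

theorem one_le_norm_sub_realRoot_pow {m : ℕ} (hm : m ≠ 0) {R : ℝ} (hR : √3 * R = m * Real.pi)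
    {w : ℂ} (hw : ‖w‖ = (2 * R) ^ 3) (n : ℕ) : 1 ≤ ‖w - (-2 * (realRoot n : ℂ)) ^ 3‖ := by
  have hr := realRoot_pos n
  have hR_ge := one_le_of_sqrt_three_mul_eq hm hR
  calc 1 ≤ 8 * (R ^ 2 + R * realRoot n + realRoot n ^ 2) * (1 / 4) := by
        nlinarith [mul_pos (one_pos.trans_le hR_ge) hr]
    _ ≤ 8 * (R ^ 2 + R * realRoot n + realRoot n ^ 2) * |R - realRoot n| := by
        gcongr
        exact one_quarter_le_abs_sub_realRoot hR n
    _ = |(2 * R) ^ 3 - (2 * realRoot n) ^ 3| := by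
        rw [← abs_of_pos (show 0 < 8 * (R ^ 2 + R * realRoot n + realRoot n ^ 2) by positivity),
          ← abs_mul]
        ring_nf
    _ ≤ ‖w - (-2 * (realRoot n : ℂ)) ^ 3‖ := by
        rw [← hw, ← norm_neg_two_mul_realRoot_pow]
        exact abs_norm_sub_norm_le _ _

theorem deriv_logDeriv_mittagLeffler_three_zero :
    deriv (logDeriv (mittagLeffler 3)) 0 = -1 / 40 := by
  rw [deriv_logDeriv_mittagLeffler_zero three_ne_zero]
  norm_num [Nat.factorial]

theorem norm_sum_inv_realRoot_pow_sub_le {m : ℕ} (hm : m ≠ 0) {R : ℝ}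
    (hR : √3 * R = m * Real.pi) :
    ‖∑ n ∈ Finset.range m, (((-2 * (realRoot n : ℂ)) ^ 3) ^ 2)⁻¹ - 1 / 40‖ ≤
      (1 + m) / (2 * R) ^ 3 := by
  have hR_ge := one_le_of_sqrt_three_mul_eq hm hR
  have hroot (n : ℕ) : mittagLeffler 3 ((-2 * (realRoot n : ℂ)) ^ 3) = 0 :=
    mittagLeffler_three_eq_zero_iff.2 ⟨n, rfl⟩
  have hall (w) (hw : w ∈ Metric.closedBall 0 ((2 * R) ^ 3)) (h : mittagLeffler 3 w = 0) :
      ∃ n ∈ Finset.range m, (-2 * (realRoot n : ℂ)) ^ 3 = w := by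
    obtain ⟨n, rfl⟩ := mittagLeffler_three_eq_zero_iff.1 h
    rw [mem_closedBall_zero_iff, norm_neg_two_mul_realRoot_pow,
      pow_le_pow_iff_left₀ (by linarith [realRoot_pos n]) (by linarith) three_ne_zero] at hw
    exact ⟨n, Finset.mem_range.2 (lt_of_realRoot_le hR (by linarith)), rfl⟩
  have h := norm_iteratedDeriv_logDeriv_add_sum_le 1 (by positivity) one_pos
    (analyticOnNhd_mittagLeffler three_ne_zero _)
    ((mittagLeffler_apply_zero three_ne_zero).trans_ne one_ne_zero)
    injective_neg_two_mul_realRoot_pow.injOn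
    (fun n _ => ⟨hroot n, deriv_mittagLeffler_three_ne_zero (hroot n)⟩) hall
    (fun w hw => norm_logDeriv_mittagLeffler_three_le hm hR (mem_sphere_zero_iff_norm.1 hw))
    (fun w hw n _ => one_le_norm_sub_realRoot_pow hm hR (mem_sphere_zero_iff_norm.1 hw) n)
  rw [iteratedDeriv_one, deriv_logDeriv_mittagLeffler_three_zero] at h
  simpa [sub_eq_add_neg, add_comm, neg_div] using h

theorem abs_sum_realRoot_zpow_sub_le {m : ℕ} (hm : m ≠ 0) :
    |∑ n ∈ Finset.range m, realRoot n ^ (-6 : ℤ) - 8 / 5| ≤ 16 / m := by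
  have hm_ge : (1 : ℝ) ≤ m := by exact_mod_cast Nat.one_le_iff_ne_zero.2 hm
  obtain ⟨R, hR⟩ : ∃ R, √3 * R = m * Real.pi :=
    ⟨m * Real.pi / √3, mul_div_cancel₀ _ (by positivity)⟩
  have hR_ge : m ≤ R := by
    refine le_of_mul_le_mul_left ?_ (show 0 < √3 by positivity)
    rw [hR]
    nlinarith [sqrt_three_le_two, Real.pi_gt_three]
  have hsum : ∑ n ∈ Finset.range m, (((-2 * (realRoot n : ℂ)) ^ 3) ^ 2)⁻¹ - 1 / 40 =
      ((∑ n ∈ Finset.range m, realRoot n ^ (-6 : ℤ) - 8 / 5 : ℝ) : ℂ) / 64 := by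
    have hterm (x : ℂ) : (((-2 * x) ^ 3) ^ 2)⁻¹ = x ^ (-6 : ℤ) / 64 := by
      rw [← pow_mul, mul_pow, mul_inv, zpow_neg, div_eq_inv_mul]
      norm_num
    simp_rw [hterm]
    rw [← Finset.sum_div]
    push_cast
    ring
  have hbound := norm_sum_inv_realRoot_pow_sub_le hm hR
  rw [hsum, norm_div, Complex.norm_real, Real.norm_eq_abs, Complex.norm_ofNat,
    div_le_iff₀ (by norm_num)] at hbound
  calc _ ≤ (1 + m) / (2 * R) ^ 3 * 64 := hbound
    _ ≤ (m + m) / (2 * m) ^ 3 * 64 := by gcongr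
    _ = 16 / m / m := by
        field_simp
        norm_num
    _ ≤ 16 / m := div_le_self (by positivity) hm_ge

theorem hasSum_realRoot : HasSum (fun n : ℕ => realRoot n ^ (-6 : ℤ)) (8 / 5) := by
  rw [hasSum_iff_tendsto_nat_of_nonneg fun n => zpow_nonneg (realRoot_pos n).le _,
    tendsto_iff_norm_sub_tendsto_zero]
  refine squeeze_zero' (Filter.Eventually.of_forall fun _ => norm_nonneg _) ?_
    (tendsto_const_div_atTop_nhds_zero_nat 16)
  filter_upwards [Filter.eventually_ne_atTop 0] with m hm
  exact abs_sum_realRoot_zpow_sub_le hm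

theorem mainTheorem2 :
    ∃ r : ℕ → ℝ,
      StrictMono r ∧
      Set.range r = {x : ℝ | 2 * Real.cos (Real.sqrt 3 * x) = -Real.exp (-3 * x)} ∧
      (∀ n, 0 < r n) ∧
      HasSum (fun n : ℕ => r n ^ (-6 : ℤ)) (8 / 5) ∧
      {z : ℂ | cosExpFun z = 0} =
        {z : ℂ | ∃ n : ℕ, z = (r n : ℂ) ∨ z = cubeRootUnity * (r n : ℂ) ∨
          z = cubeRootUnity ^ 2 * (r n : ℂ)} ∧
      (∀ z : ℂ, cosExpFun z = 0 → analyticOrderAt cosExpFun z = 1) :=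
  ⟨realRoot, strictMono_realRoot, range_realRoot, realRoot_pos, hasSum_realRoot,
    Set.ext fun _ => cosExpFun_eq_zero_iff_exists, fun _ h => analyticOrderAt_cosExpFun h⟩
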